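/- Let $\alpha>-1$ and $\lambda\in\mathbb{R}$, and for $t>0$ let $w(x;t)=x^{\alpha}e^{-x}(x+t)^{\lambda}$, $x\in(0,\infty)$. For each $t>0$ there is exactly one sequence of monic polynomials $P_j(x;t)$, $\deg P_j=j$ ($j=0,1,2,\dots$), that is orthogonal with respect to $w(\cdot\,;t)$ on $(0,\infty)$, that is, $$\int_0^\infty P_j(x;t)P_k(x;t)\,w(x;t)\,dx=h_j(t)\,\delta_{jk},\qquad j,k=0,1,2,\dots,$$ and the constants $h_j(t)=\int_0^\infty P_j(x;t)^2\,w(x;t)\,dx$ are positive. For every fixed $n\in\{0,1,2,\dots\}$, as $t\to+\infty$, $$\ln h_n(t)=\lambda\ln t+\ln\bigl(\Gamma(n+1)\Gamma(n+\alpha+1)\bigr)+\frac{\lambda(2n+\alpha+1)}{t}-\frac{\lambda\left[6n^2+2n(3\alpha-\lambda+3)+(\alpha+1)(\alpha-\lambda+2)\right]}{2t^2}+O(t^{-3}),$$ where the implied constant may depend on $n$, $\alpha$ and $\lambda$. -/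

import Mathlib

open Polynomial Filter Asymptotics MeasureTheory

/-- The deformed Laguerre weight `w(x; t) = x ^ α * e ^ (-x) * (x + t) ^ lam`, for `x > 0`. -/
noncomputable def deformedLaguerreWeight (α lam t x : ℝ) : ℝ :=
  x ^ α * Real.exp (-x) * (x + t) ^ lam

/-- The integral `∫_0^∞ p(x) q(x) w(x; t) dx`. -/
noncomputable def weightedInner (α lam t : ℝ) (p q : ℝ[X]) : ℝ :=
  ∫ x in Set.Ioi (0 : ℝ), p.eval x * q.eval x * deformedLaguerreWeight α lam t x

/-- `P` is a sequence of monic polynomials, `P j` of degree `j`, pairwise orthogonal with respect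
to the weight `w(x; t)` on `(0, ∞)`. -/
structure IsMonicOrthogonalSequence (α lam t : ℝ) (P : ℕ → ℝ[X]) : Prop where
  monic : ∀ j, (P j).Monic
  natDegree_eq : ∀ j, (P j).natDegree = j
  orthogonal : ∀ j k, j ≠ k → weightedInner α lam t (P j) (P k) = 0

/-! With `ε = 1/t` the weight is `t ^ λ` times `x ^ α e ^ (-x) (1 + ε x) ^ λ`, so the claim is a
perturbation problem at `ε = 0`, where the orthogonal polynomials are the monic Laguerre polynomials
`L n`, with squared norm `H = Γ(n+1) Γ(n+α+1)`. Let `Φ_ε` be integration against this rescaled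
weight.

Write `P n = L n + ε q + r`, where `q = -λ n (n + α) L (n-1)` makes `L n + ε q` orthogonal to lower
degrees up to first order (`exists_first_order_correction`). Since `P n ⟂ r`, Pythagoras gives
`Φ_ε(P n ^ 2) = Φ_ε((L n + ε q) ^ 2) - Φ_ε(r ^ 2)`, and the last term is `O(ε ^ 4)`
(`exists_deformedFunctional_correction_le`). The first term is expanded by Taylor's formula for `(1
+ ε x) ^ λ` under the integral (`exists_abs_deformedFunctional_sub_le`). The Laguerre averages of
`x` and `x ^ 2` that appear follow algebraically from one integration by parts identity
(`apply_X_mul`). Taking logarithms finishes the proof. -/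

/-! ### Monic orthogonal polynomials for an abstract linear functional. -/

/-- `P` is a sequence of monic polynomials, `P j` of degree `j`, pairwise orthogonal with respect
to the linear functional `Φ`. -/
structure IsMonicOrthogonalFor (Φ : ℝ[X] →ₗ[ℝ] ℝ) (P : ℕ → ℝ[X]) : Prop where
  monic : ∀ j, (P j).Monic
  natDegree_eq : ∀ j, (P j).natDegree = j
  orthogonal : ∀ j k, j ≠ k → Φ (P j * P k) = 0

/-- Subtracting the leading term along a monic polynomial of degree `m` lowers the degree. -/
theorem degree_sub_smul_monic_lt {p q : ℝ[X]} {m : ℕ} (hp : p.Monic) (hpm : p.natDegree = m)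
    (hq : q.degree < (m + 1 : ℕ)) : (q - q.coeff m • p).degree < m := by
  rw [degree_lt_iff_coeff_zero] at hq ⊢
  intro k hk
  rcases hk.eq_or_lt with rfl | hk
  · have : p.coeff m = 1 := by rw [← hpm]; exact hp
    simp [this]
  · simp [hq k hk, coeff_eq_zero_of_natDegree_lt (hpm.trans_lt hk)]

namespace IsMonicOrthogonalFor

variable {Φ : ℝ[X] →ₗ[ℝ] ℝ} {P Q : ℕ → ℝ[X]}

theorem coeff_self (hP : IsMonicOrthogonalFor Φ P) (n : ℕ) : (P n).coeff n = 1 := by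
  have := hP.monic n
  rwa [Monic, leadingCoeff, hP.natDegree_eq n] at this

theorem coeff_of_lt (hP : IsMonicOrthogonalFor Φ P) {n m : ℕ} (h : n < m) : (P n).coeff m = 0 :=
  coeff_eq_zero_of_natDegree_lt ((hP.natDegree_eq n).trans_lt h)

theorem apply_mul_of_degree_lt_of_le (hP : IsMonicOrthogonalFor Φ P) {n m : ℕ} (hm : m ≤ n)
    {q : ℝ[X]} (hq : q.degree < m) : Φ (P n * q) = 0 := by
  induction m generalizing q with
  | zero =>
    have : q = 0 := by
      rw [degree_lt_iff_coeff_zero] at hq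
      ext k
      simpa using hq k (Nat.zero_le k)
    simp [this]
  | succ m ih =>
    have h1 := ih (by omega) (degree_sub_smul_monic_lt (hP.monic m) (hP.natDegree_eq m) hq)
    rwa [mul_sub, mul_smul_comm, map_sub, map_smul, hP.orthogonal n m (by omega), smul_zero,
      sub_zero] at h1

theorem apply_mul_of_degree_lt (hP : IsMonicOrthogonalFor Φ P) {n : ℕ}
    {q : ℝ[X]} (hq : q.degree < n) : Φ (P n * q) = 0 :=
  hP.apply_mul_of_degree_lt_of_le le_rfl hq

/-- Pairing `P n` with a polynomial of degree at most `n` only sees the coefficient of `X ^ n`. -/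
theorem apply_mul_eq_coeff (hP : IsMonicOrthogonalFor Φ P) {n : ℕ}
    {q : ℝ[X]} (hq : q.degree < (n + 1 : ℕ)) : Φ (P n * q) = q.coeff n * Φ (P n * P n) := by
  have h1 := hP.apply_mul_of_degree_lt
    (degree_sub_smul_monic_lt (hP.monic n) (hP.natDegree_eq n) hq)
  rw [mul_sub, mul_smul_comm, map_sub, map_smul, smul_eq_mul] at h1
  linarith

theorem degree_sub_lt (hP : IsMonicOrthogonalFor Φ P) {n : ℕ} {p : ℝ[X]} (hp : p.Monic)
    (hpn : p.natDegree = n) : (P n - p).degree < n := by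
  have h := degree_sub_smul_monic_lt (q := P n) hp hpn (by
    rw [degree_lt_iff_coeff_zero]
    exact fun m hm => hP.coeff_of_lt hm)
  rwa [hP.coeff_self, one_smul] at h

/-- The difference `P n - Q n` has degree below `n`, so both `P n` and `Q n` annihilate it; its own
square then has `Φ`-value zero. -/
theorem eq_of_pos (hΦ : ∀ p ≠ 0, 0 < Φ (p * p)) (hP : IsMonicOrthogonalFor Φ P)
    (hQ : IsMonicOrthogonalFor Φ Q) : P = Q := by
  funext n
  by_contra hne
  have hd := hP.degree_sub_lt (hQ.monic n) (hQ.natDegree_eq n)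
  have h1 := hP.apply_mul_of_degree_lt hd
  have h2 := hQ.apply_mul_of_degree_lt hd
  have h3 := hΦ _ (sub_ne_zero.mpr hne)
  rw [sub_mul, map_sub, h1, h2] at h3
  simp at h3

/-- `x P_n' - n P_n` has degree less than `n`. -/
theorem degree_X_mul_derivative_sub_lt (hP : IsMonicOrthogonalFor Φ P) (n : ℕ) :
    (X * derivative (P n) - (n : ℝ) • P n).degree < (n : WithBot ℕ) := by
  rw [degree_lt_iff_coeff_zero]
  intro m hm
  rw [coeff_sub, coeff_smul]
  rcases m with _ | m
  · obtain rfl : n = 0 := by omega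
    simp
  · rw [coeff_X_mul, coeff_derivative]
    rcases hm.eq_or_lt with rfl | h
    · simp [hP.coeff_self]
    · simp [hP.coeff_of_lt h]

end IsMonicOrthogonalFor

/-! ### Existence by Gram–Schmidt. -/

/-- The Gram–Schmidt process for the monomials with respect to a functional. -/
noncomputable def gramSchmidtMonic (Φ : ℝ[X] →ₗ[ℝ] ℝ) (n : ℕ) : ℝ[X] :=
  X ^ n - ∑ k : Fin n, (Φ (X ^ n * gramSchmidtMonic Φ k) /
    Φ (gramSchmidtMonic Φ k * gramSchmidtMonic Φ k)) • gramSchmidtMonic Φ k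
termination_by n
decreasing_by all_goals exact k.2

theorem gramSchmidtMonic_monic_and_natDegree (Φ : ℝ[X] →ₗ[ℝ] ℝ) (n : ℕ) :
    (gramSchmidtMonic Φ n).Monic ∧ (gramSchmidtMonic Φ n).natDegree = n := by
  induction n using Nat.strong_induction_on with
  | _ n ih =>
    have hd : (∑ k : Fin n, (Φ (X ^ n * gramSchmidtMonic Φ k) /
        Φ (gramSchmidtMonic Φ k * gramSchmidtMonic Φ k)) • gramSchmidtMonic Φ k).degree < n := by
      refine (degree_sum_le _ _).trans_lt ((Finset.sup_lt_iff (WithBot.bot_lt_coe n)).mpr ?_)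
      intro k _
      refine (degree_smul_le _ _).trans_lt (degree_le_natDegree.trans_lt ?_)
      rw [(ih k k.2).2]
      exact WithBot.coe_lt_coe.mpr k.2
    rw [gramSchmidtMonic]
    refine ⟨monic_X_pow_sub hd, natDegree_eq_of_degree_eq_some ?_⟩
    rw [degree_sub_eq_left_of_degree_lt (by rwa [degree_X_pow]), degree_X_pow]

theorem isMonicOrthogonalFor_gramSchmidtMonic {Φ : ℝ[X] →ₗ[ℝ] ℝ} (hΦ : ∀ p ≠ 0, 0 < Φ (p * p)) :
    IsMonicOrthogonalFor Φ (gramSchmidtMonic Φ) := by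
  have key : ∀ n, ∀ k < n, Φ (gramSchmidtMonic Φ n * gramSchmidtMonic Φ k) = 0 := by
    intro n
    induction n using Nat.strong_induction_on with
    | _ n ih =>
      intro k hk
      rw [gramSchmidtMonic, sub_mul, map_sub, Finset.sum_mul, map_sum,
        Finset.sum_eq_single (⟨k, hk⟩ : Fin n)]
      · have := hΦ _ (gramSchmidtMonic_monic_and_natDegree Φ k).1.ne_zero
        rw [smul_mul_assoc, map_smul, smul_eq_mul, div_mul_cancel₀ _ this.ne', sub_self]
      · intro j _ hj
        rw [smul_mul_assoc, map_smul]
        rcases lt_or_gt_of_ne (fun h => hj (Fin.ext h) : (j : ℕ) ≠ k) with h | h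
        · rw [mul_comm (gramSchmidtMonic Φ j) (gramSchmidtMonic Φ k), ih k hk j h, smul_zero]
        · rw [ih j j.2 k h, smul_zero]
      · simp
  refine ⟨fun j => (gramSchmidtMonic_monic_and_natDegree Φ j).1,
    fun j => (gramSchmidtMonic_monic_and_natDegree Φ j).2, fun j k hjk => ?_⟩
  rcases lt_or_gt_of_ne hjk with h | h
  · rw [mul_comm]; exact key k j h
  · exact key j k h

/-! ### Algebra of the Laguerre polynomials, from the moments alone. -/

/-- The moments of `Φ` are those of the Laguerre weight `x ^ α * e ^ (-x)` on `(0, ∞)`. -/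
def HasLaguerreMoments (α : ℝ) (Φ : ℝ[X] →ₗ[ℝ] ℝ) : Prop :=
  ∀ k : ℕ, Φ (X ^ k) = Real.Gamma (α + k + 1)

namespace HasLaguerreMoments

variable {α : ℝ} {Φ : ℝ[X] →ₗ[ℝ] ℝ} {L : ℕ → ℝ[X]}

/-- Integration by parts for the Laguerre functional. -/
theorem apply_X_mul (hα : -1 < α) (hΦ : HasLaguerreMoments α Φ) (f : ℝ[X]) :
    Φ (X * f) = Φ (X * derivative f) + (α + 1) * Φ f := by
  -- Both sides are linear in `f`; on monomials the identity is `Γ(s + 1) = s Γ(s)`.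
  induction f using Polynomial.induction_on' with
  | add p q hp hq => rw [mul_add, map_add, hp, hq, derivative_add, mul_add, map_add, map_add]; ring
  | monomial k a =>
    have h1 : X * monomial k a = a • X ^ (k + 1) := by
      rw [X_mul_monomial, ← C_mul_X_pow_eq_monomial, smul_eq_C_mul]
    have h2 : X * derivative (monomial k a) = (a * k) • X ^ k := by
      rw [derivative_monomial, X_mul_monomial, smul_eq_C_mul, C_mul_X_pow_eq_monomial]
      rcases k with _ | k
      · simp
      · simp
    have h3 : (monomial k a : ℝ[X]) = a • X ^ k := by
      rw [← C_mul_X_pow_eq_monomial, smul_eq_C_mul]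
    have hk : α + k + 1 ≠ 0 := by
      have : (0 : ℝ) ≤ k := k.cast_nonneg
      linarith
    rw [h1, h2, h3, map_smul, map_smul, map_smul, hΦ, hΦ]
    push_cast
    rw [show α + ((k : ℝ) + 1) + 1 = (α + k + 1) + 1 by ring, Real.Gamma_add_one hk]
    simp only [smul_eq_mul]
    ring

variable (hα : -1 < α) (hΦ : HasLaguerreMoments α Φ) (hL : IsMonicOrthogonalFor Φ L)
include hα hΦ hL

/-- Integrate by parts with `f = L n ^ 2`: the derivative term is twice the pairing of `L n` with `X
* (L n)'`, which has degree at most `n` and `X ^ n` coefficient `n`. -/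
theorem apply_X_mul_self_mul_self (n : ℕ) :
    Φ (L n * (X * L n)) = (2 * n + α + 1) * Φ (L n * L n) := by
  have h1 := hΦ.apply_X_mul hα (L n * L n)
  have h2 : Φ (L n * (X * derivative (L n))) = n * Φ (L n * L n) := by
    rw [hL.apply_mul_eq_coeff]
    · congr 1
      rcases n with _ | n
      · simp
      · rw [coeff_X_mul, coeff_derivative, hL.coeff_self]; push_cast; ring
    · rw [degree_lt_iff_coeff_zero]
      intro m hm
      obtain ⟨m, rfl⟩ : ∃ k, m = k + 1 := ⟨m - 1, by omega⟩
      rw [coeff_X_mul, coeff_derivative, hL.coeff_of_lt (by omega), zero_mul]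
  rw [show X * derivative (L n * L n) = (2 : ℝ) • (L n * (X * derivative (L n))) by
    rw [derivative_mul, smul_eq_C_mul, show (C (2 : ℝ)) = 2 from rfl]; ring, map_smul, h2,
    show X * (L n * L n) = L n * (X * L n) by ring, smul_eq_mul] at h1
  rw [h1]; ring

/-- Pair `L n` with `X * L n - L (n + 1)`, of degree at most `n`. The subleading coefficient of `L
n` is written `(X * L n).coeff n`, which avoids the index `n - 1` and is `0` at `n = 0`. -/
theorem coeff_X_mul_sub (n : ℕ) (hn : Φ (L n * L n) ≠ 0) :
    (X * L n).coeff n - (X * L (n + 1)).coeff (n + 1) = 2 * n + α + 1 := by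
  have h1 := hΦ.apply_X_mul_self_mul_self hα hL n
  have h2 : Φ (L n * (X * L n - L (n + 1))) =
      (X * L n - L (n + 1)).coeff n * Φ (L n * L n) := by
    apply hL.apply_mul_eq_coeff
    rw [degree_lt_iff_coeff_zero]
    intro m hm
    obtain ⟨m, rfl⟩ : ∃ k, m = k + 1 := ⟨m - 1, by omega⟩
    rw [coeff_sub, coeff_X_mul]
    rcases (show n ≤ m by omega).eq_or_lt with rfl | h
    · rw [hL.coeff_self, hL.coeff_self, sub_self]
    · rw [hL.coeff_of_lt h, hL.coeff_of_lt (by omega), sub_self]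
  rw [mul_sub, map_sub, hL.orthogonal n (n + 1) (by omega), sub_zero, h1] at h2
  rw [coeff_X_mul]
  exact (mul_right_cancel₀ hn h2).symm

/-- Telescoping: the sum of `2 k + α + 1` over `k < n` is `n (n + α)`. -/
theorem coeff_X_mul_self (h0 : ∀ n, Φ (L n * L n) ≠ 0) (n : ℕ) :
    (X * L n).coeff n = -(n * (n + α)) := by
  induction n with
  | zero => simp
  | succ n ih =>
    have := hΦ.coeff_X_mul_sub hα hL n (h0 n)
    push_cast
    linarith

/-- Integrate `L (n + 1) * L n` by parts. Only `L n * (X * (L (n + 1))')` survives on the right;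
modulo `L (n + 1)`, its second factor has degree at most `n`, and its `X ^ n` coefficient is minus
the subleading coefficient of `L (n + 1)`. -/
theorem apply_self_mul_self_succ (h0 : ∀ n, Φ (L n * L n) ≠ 0) (n : ℕ) :
    Φ (L (n + 1) * L (n + 1)) = (n + 1) * (n + 1 + α) * Φ (L n * L n) := by
  have h1 := hΦ.apply_X_mul hα (L (n + 1) * L n)
  have h2 : Φ (L (n + 1) * (X * L n)) = Φ (L (n + 1) * L (n + 1)) := by
    rw [hL.apply_mul_eq_coeff, coeff_X_mul, hL.coeff_self, one_mul]
    rw [degree_lt_iff_coeff_zero]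
    intro m hm
    obtain ⟨m, rfl⟩ : ∃ k, m = k + 1 := ⟨m - 1, by omega⟩
    rw [coeff_X_mul, hL.coeff_of_lt (by omega)]
  have h3 : Φ (L (n + 1) * (X * derivative (L n))) = 0 := by
    apply hL.apply_mul_of_degree_lt
    rw [degree_lt_iff_coeff_zero]
    intro m hm
    obtain ⟨m, rfl⟩ : ∃ k, m = k + 1 := ⟨m - 1, by omega⟩
    rw [coeff_X_mul, coeff_derivative, hL.coeff_of_lt (by omega), zero_mul]
  have h4 := hL.degree_X_mul_derivative_sub_lt (n + 1)
  have h5 := hL.apply_mul_eq_coeff h4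
  have h6 := hΦ.coeff_X_mul_self hα hL h0 (n + 1)
  have h7 : (X * derivative (L (n + 1)) - ((n + 1 : ℕ) : ℝ) • L (n + 1)).coeff n =
      (n + 1) * (n + 1 + α) := by
    rw [coeff_X_mul] at h6
    push_cast at h6 ⊢
    rw [coeff_sub, coeff_smul, h6]
    rcases n with _ | n
    · simp
    · rw [coeff_X_mul, coeff_derivative, h6]
      push_cast
      simp only [smul_eq_mul]
      ring
  rw [h7, mul_sub, map_sub, mul_smul_comm, map_smul, hL.orthogonal n (n + 1) (by omega),
    smul_zero, sub_zero] at h5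
  rw [hL.orthogonal (n + 1) n (by omega), mul_zero, add_zero, derivative_mul,
    show X * (L (n + 1) * L n) = L (n + 1) * (X * L n) by ring, h2,
    show X * (derivative (L (n + 1)) * L n + L (n + 1) * derivative (L n)) =
      L n * (X * derivative (L (n + 1))) + L (n + 1) * (X * derivative (L n)) by ring,
    map_add, h3, add_zero] at h1
  rw [h1, h5]

theorem apply_self_mul_self (h0 : ∀ n, Φ (L n * L n) ≠ 0) (n : ℕ) :
    Φ (L n * L n) = Real.Gamma (n + 1) * Real.Gamma (n + α + 1) := by
  induction n with
  | zero =>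
    have h1 : L 0 = 1 := by
      rw [eq_C_of_natDegree_eq_zero (hL.natDegree_eq 0), hL.coeff_self, C_1]
    have := hΦ 0
    rw [h1, mul_one, ← pow_zero X, this]
    simp
  | succ n ih =>
    have hn : (0 : ℝ) ≤ n := n.cast_nonneg
    rw [hΦ.apply_self_mul_self_succ hα hL h0, ih]
    push_cast
    rw [Real.Gamma_add_one (show (n : ℝ) + 1 ≠ 0 by positivity),
      show (n : ℝ) + 1 + α + 1 = (n + α + 1) + 1 by ring,
      Real.Gamma_add_one (show (n : ℝ) + α + 1 ≠ 0 by linarith)]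
    ring

/-- Integrate `X * L n ^ 2` by parts and split `X * (L n)'` as `n • L n` plus a lower-degree term.
That term times `X` has `X ^ n` coefficient `n (n + α)`, minus the subleading coefficient of `L n`.
-/
theorem apply_X_sq_mul_self_mul_self (h0 : ∀ n, Φ (L n * L n) ≠ 0) (n : ℕ) :
    Φ (X * X * (L n * L n)) =
      ((2 * n + α + 1) * (2 * n + α + 2) + 2 * (n * (n + α))) * Φ (L n * L n) := by
  have h1 := hΦ.apply_X_mul hα (X * (L n * L n))
  have h2 := hΦ.apply_X_mul_self_mul_self hα hL n
  have h3 : Φ (L n * (X * (X * derivative (L n) - (n : ℝ) • L n))) =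
      n * (n + α) * Φ (L n * L n) := by
    have h4 := hL.degree_X_mul_derivative_sub_lt n
    have h6 := hΦ.coeff_X_mul_self hα hL h0 n
    rw [hL.apply_mul_eq_coeff]
    · congr 1
      rcases n with _ | n
      · simp
      · rw [coeff_X_mul] at h6 ⊢
        rw [coeff_sub, coeff_smul, h6]
        push_cast at h6 ⊢
        rcases n with _ | n
        · simp
        · rw [coeff_X_mul, coeff_derivative, h6]
          push_cast
          simp only [smul_eq_mul]
          ring
    · rw [degree_lt_iff_coeff_zero] at h4 ⊢
      intro m hm
      obtain ⟨m, rfl⟩ : ∃ k, m = k + 1 := ⟨m - 1, by omega⟩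
      rw [coeff_X_mul, h4 m (by omega)]
  have h8 : X * derivative (X * (L n * L n)) = L n * (X * L n) +
      (2 : ℝ) • (L n * (X * (X * derivative (L n) - (n : ℝ) • L n))) +
      (2 * n : ℝ) • (L n * (X * L n)) := by
    simp only [derivative_mul, derivative_X, smul_eq_C_mul, C_mul, show (C (2 : ℝ)) = 2 from rfl]
    ring
  rw [h8, map_add, map_add, map_smul, map_smul, h3, show X * (L n * L n) = L n * (X * L n) by ring,
    h2, smul_eq_mul, smul_eq_mul] at h1
  rw [show X * X * (L n * L n) = X * (L n * (X * L n)) by ring, h1]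
  ring

end HasLaguerreMoments

/-! ### Taylor remainders of `(1 + u) ^ s` with polynomial bounds on the whole half-line. -/

/-- If `f 0 = 0` and `|f'|` is bounded by `C u ^ k (1 + u) ^ N`, then `|f|` is bounded by
`C u ^ (k + 1) (1 + u) ^ N`. -/
theorem abs_le_of_abs_deriv_le {f f' : ℝ → ℝ} {C : ℝ} {k N : ℕ}
    (hf : ∀ u, 0 ≤ u → HasDerivAt f (f' u) u) (h0 : f 0 = 0) (hC : 0 ≤ C)
    (hb : ∀ u, 0 ≤ u → |f' u| ≤ C * u ^ k * (1 + u) ^ N) (u : ℝ) (hu : 0 ≤ u) :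
    |f u| ≤ C * u ^ (k + 1) * (1 + u) ^ N := by
  have h := Convex.norm_image_sub_le_of_norm_hasDerivWithin_le (f := f) (f' := f')
    (s := Set.Icc 0 u) (x := 0) (y := u) (C := C * u ^ k * (1 + u) ^ N)
    (fun x hx => (hf x hx.1).hasDerivWithinAt)
    (fun x hx => by
      refine (hb x hx.1).trans ?_
      have h1 := hx.1
      have h2 := hx.2
      gcongr)
    (convex_Icc 0 u) ⟨le_rfl, hu⟩ ⟨hu, le_rfl⟩
  rw [h0, sub_zero, sub_zero, Real.norm_eq_abs, Real.norm_eq_abs, abs_of_nonneg hu] at h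
  exact h.trans_eq (by ring)

/-- A natural exponent makes the majorant a polynomial, hence integrable against the Laguerre
measure. The absolute value lets the same exponent bound the power `-s` as well. -/
theorem rpow_one_add_le_pow (s : ℝ) {u : ℝ} (hu : 0 ≤ u) :
    (1 + u) ^ s ≤ (1 + u) ^ ⌈|s|⌉₊ := by
  rw [← Real.rpow_natCast]
  exact Real.rpow_le_rpow_of_exponent_le (by linarith) ((le_abs_self s).trans (Nat.le_ceil _))

theorem hasDerivAt_rpow_one_add (s : ℝ) {u : ℝ} (hu : 0 ≤ u) :
    HasDerivAt (fun x : ℝ => (1 + x) ^ s) (s * (1 + u) ^ (s - 1)) u := by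
  have h := ((hasDerivAt_id u).const_add 1).rpow_const (p := s) (Or.inl (by simp; linarith))
  simpa using h

theorem exists_abs_rpow_one_add_sub_one_le (s : ℝ) : ∃ C : ℝ, ∃ N : ℕ, 0 ≤ C ∧
    ∀ u, 0 ≤ u → |(1 + u) ^ s - 1| ≤ C * u ^ 1 * (1 + u) ^ N := by
  refine ⟨|s|, ⌈|s - 1|⌉₊, abs_nonneg s, ?_⟩
  refine abs_le_of_abs_deriv_le (k := 0)
    (fun u hu => (hasDerivAt_rpow_one_add s hu).sub_const 1) (by simp) (abs_nonneg s) ?_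
  intro u hu
  rw [abs_mul, abs_of_nonneg (Real.rpow_nonneg (by linarith) _), pow_zero, mul_one]
  gcongr
  exact rpow_one_add_le_pow _ hu

/-- The derivative of the remainder is `s` times the remainder of one order less for the exponent `s
- 1`. The quadratic case repeats this. -/
theorem exists_abs_rpow_one_add_sub_linear_le (s : ℝ) : ∃ C : ℝ, ∃ N : ℕ, 0 ≤ C ∧
    ∀ u, 0 ≤ u → |(1 + u) ^ s - 1 - s * u| ≤ C * u ^ 2 * (1 + u) ^ N := by
  obtain ⟨C, N, hC, h⟩ := exists_abs_rpow_one_add_sub_one_le (s - 1)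
  refine ⟨|s| * C, N, by positivity, ?_⟩
  refine abs_le_of_abs_deriv_le (k := 1) (fun u hu =>
    ((hasDerivAt_rpow_one_add s hu).sub_const 1).sub ((hasDerivAt_id' u).const_mul s))
    (by simp) (by positivity) ?_
  intro u hu
  rw [show s * (1 + u) ^ (s - 1) - s * 1 = s * ((1 + u) ^ (s - 1) - 1) by ring, abs_mul,
    mul_assoc, mul_assoc, ← mul_assoc C]
  gcongr
  exact h u hu

theorem exists_abs_rpow_one_add_sub_quadratic_le (s : ℝ) : ∃ C : ℝ, ∃ N : ℕ, 0 ≤ C ∧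
    ∀ u, 0 ≤ u →
      |(1 + u) ^ s - 1 - s * u - s * (s - 1) / 2 * u ^ 2| ≤ C * u ^ 3 * (1 + u) ^ N := by
  obtain ⟨C, N, hC, h⟩ := exists_abs_rpow_one_add_sub_linear_le (s - 1)
  refine ⟨|s| * C, N, by positivity, ?_⟩
  refine abs_le_of_abs_deriv_le (k := 2) (fun u hu =>
    (((hasDerivAt_rpow_one_add s hu).sub_const 1).sub ((hasDerivAt_id' u).const_mul s)).sub
      ((hasDerivAt_pow 2 u).const_mul (s * (s - 1) / 2)))
    (by simp) (by positivity) ?_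
  intro u hu
  rw [show s * (1 + u) ^ (s - 1) - s * 1 - s * (s - 1) / 2 * (((2 : ℕ) : ℝ) * u ^ (2 - 1)) =
    s * ((1 + u) ^ (s - 1) - 1 - (s - 1) * u) by push_cast; ring, abs_mul,
    mul_assoc, mul_assoc, ← mul_assoc C]
  gcongr
  exact h u hu

/-! ### The Laguerre measure and the deformed functional. -/

/-- The measure `x ^ α * e ^ (-x) dx` on `(0, ∞)`. -/
noncomputable def laguerreMeasure (α : ℝ) : Measure ℝ :=
  (volume.restrict (Set.Ioi 0)).withDensity fun x => ENNReal.ofReal (x ^ α * Real.exp (-x))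

section LaguerreMeasure

theorem measurable_laguerreDensity (α : ℝ) :
    Measurable fun x : ℝ => ENNReal.ofReal (x ^ α * Real.exp (-x)) := by fun_prop

theorem toReal_laguerreDensity (α : ℝ) {x : ℝ} (hx : 0 < x) :
    (ENNReal.ofReal (x ^ α * Real.exp (-x))).toReal = x ^ α * Real.exp (-x) :=
  ENNReal.toReal_ofReal (by positivity)

theorem integral_laguerreMeasure (α : ℝ) (g : ℝ → ℝ) :
    ∫ x, g x ∂laguerreMeasure α = ∫ x in Set.Ioi (0 : ℝ), g x * (x ^ α * Real.exp (-x)) := by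
  rw [laguerreMeasure, integral_withDensity_eq_integral_toReal_smul (measurable_laguerreDensity α)
    (ae_of_all _ fun x => ENNReal.ofReal_lt_top)]
  refine setIntegral_congr_fun measurableSet_Ioi fun x hx => ?_
  simp only [toReal_laguerreDensity α hx, smul_eq_mul]
  ring

theorem integrable_laguerreMeasure_iff (α : ℝ) (g : ℝ → ℝ) :
    Integrable g (laguerreMeasure α) ↔
      IntegrableOn (fun x => g x * (x ^ α * Real.exp (-x))) (Set.Ioi (0 : ℝ)) := by
  rw [laguerreMeasure, integrable_withDensity_iff (measurable_laguerreDensity α)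
    (ae_of_all _ fun x => ENNReal.ofReal_lt_top)]
  refine integrableOn_congr_fun (fun x hx => ?_) measurableSet_Ioi
  simp only [toReal_laguerreDensity α hx]

theorem ae_laguerreMeasure_pos (α : ℝ) : ∀ᵐ x ∂laguerreMeasure α, 0 < x :=
  (withDensity_absolutelyContinuous _ _).ae_le (ae_restrict_mem measurableSet_Ioi)

variable {α : ℝ}

theorem pow_mul_laguerreWeight (k : ℕ) {x : ℝ} (hx : 0 < x) :
    x ^ k * (x ^ α * Real.exp (-x)) = Real.exp (-x) * x ^ (α + k + 1 - 1) := by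
  rw [add_sub_cancel_right, Real.rpow_add hx, Real.rpow_natCast]
  ring

theorem integrable_pow_laguerreMeasure (hα : -1 < α) (k : ℕ) :
    Integrable (fun x => x ^ k) (laguerreMeasure α) := by
  rw [integrable_laguerreMeasure_iff]
  have hk : 0 < α + k + 1 := by
    have : (0 : ℝ) ≤ k := k.cast_nonneg
    linarith
  exact (integrableOn_congr_fun (fun x hx => pow_mul_laguerreWeight k hx) measurableSet_Ioi).mpr
    (Real.GammaIntegral_convergent hk)

theorem integral_pow_laguerreMeasure (hα : -1 < α) (k : ℕ) :
    ∫ x, x ^ k ∂laguerreMeasure α = Real.Gamma (α + k + 1) := by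
  have hk : 0 < α + k + 1 := by
    have : (0 : ℝ) ≤ k := k.cast_nonneg
    linarith
  rw [integral_laguerreMeasure, Real.Gamma_eq_integral hk]
  exact setIntegral_congr_fun measurableSet_Ioi fun x hx => pow_mul_laguerreWeight k hx

theorem integrable_eval_laguerreMeasure (hα : -1 < α) (p : ℝ[X]) :
    Integrable (fun x => p.eval x) (laguerreMeasure α) := by
  simp_rw [eval_eq_sum_range]
  exact integrable_finsetSum _ fun k _ => (integrable_pow_laguerreMeasure hα k).const_mul _

theorem integrable_eval_mul_rpow (hα : -1 < α) (lam : ℝ) {ε : ℝ} (hε : 0 ≤ ε) (p : ℝ[X]) :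
    Integrable (fun x => p.eval x * (1 + ε * x) ^ lam) (laguerreMeasure α) := by
  refine (integrable_eval_laguerreMeasure hα (p * (1 + C ε * X) ^ ⌈|lam|⌉₊)).mono ?_ ?_
  · exact (p.continuous.measurable.mul (by fun_prop)).aestronglyMeasurable
  · filter_upwards [ae_laguerreMeasure_pos α] with x hx
    have h : 0 ≤ ε * x := by positivity
    simp only [eval_mul, eval_pow, eval_add, eval_one, eval_C, eval_X, norm_mul]
    gcongr
    rw [Real.norm_of_nonneg (by positivity), Real.norm_of_nonneg (by positivity)]
    exact rpow_one_add_le_pow _ h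

/-- The functional `p ↦ ∫_0^∞ p(x) x ^ α e ^ (-x) (1 + ε x) ^ lam dx`. -/
noncomputable def deformedFunctional (hα : -1 < α) (lam : ℝ) {ε : ℝ} (hε : 0 ≤ ε) :
    ℝ[X] →ₗ[ℝ] ℝ where
  toFun p := ∫ x, p.eval x * (1 + ε * x) ^ lam ∂laguerreMeasure α
  map_add' p q := by
    simp_rw [eval_add, add_mul]
    exact integral_add (integrable_eval_mul_rpow hα lam hε p) (integrable_eval_mul_rpow hα lam hε q)
  map_smul' c p := by
    simp_rw [eval_smul, smul_eq_mul, mul_assoc, RingHom.id_apply]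
    exact integral_const_mul _ _

theorem deformedFunctional_apply (hα : -1 < α) (lam : ℝ) {ε : ℝ} (hε : 0 ≤ ε) (p : ℝ[X]) :
    deformedFunctional hα lam hε p = ∫ x, p.eval x * (1 + ε * x) ^ lam ∂laguerreMeasure α := rfl

theorem weightedInner_eq (hα : -1 < α) (lam : ℝ) {t : ℝ} (ht : 0 < t) (p q : ℝ[X]) :
    weightedInner α lam t p q =
      t ^ lam * deformedFunctional hα lam (inv_nonneg.mpr ht.le) (p * q) := by
  rw [deformedFunctional_apply, integral_laguerreMeasure, ← integral_const_mul, weightedInner]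
  refine setIntegral_congr_fun measurableSet_Ioi fun x hx => ?_
  have hx : 0 < x := hx
  have h1 : x + t = t * (1 + t⁻¹ * x) := by field_simp; ring
  simp only [deformedLaguerreWeight, eval_mul, h1]
  rw [Real.mul_rpow ht.le (by positivity)]
  ring

/-- The integrand is nonnegative and vanishes on `(0, ∞)` only at the finitely many roots of `p`. -/
theorem deformedFunctional_mul_self_pos (hα : -1 < α) (lam : ℝ) {ε : ℝ} (hε : 0 ≤ ε)
    (p : ℝ[X]) (hp : p ≠ 0) : 0 < deformedFunctional hα lam hε (p * p) := by
  rw [deformedFunctional_apply, integral_laguerreMeasure]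
  have hint := (integrable_laguerreMeasure_iff α _).mp (integrable_eval_mul_rpow hα lam hε (p * p))
  have hnn : 0 ≤ᵐ[volume.restrict (Set.Ioi (0 : ℝ))]
      fun x => (p * p).eval x * (1 + ε * x) ^ lam * (x ^ α * Real.exp (-x)) := by
    filter_upwards [ae_restrict_mem measurableSet_Ioi] with x hx
    have hx : 0 < x := hx
    rw [eval_mul]
    have := mul_self_nonneg (p.eval x)
    simp only [Pi.zero_apply]
    positivity
  rw [setIntegral_pos_iff_support_of_nonneg_ae hnn hint]
  have hsub : Set.Ioi (0 : ℝ) \ (p.roots.toFinset : Set ℝ) ⊆ (Function.support fun x =>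
      (p * p).eval x * (1 + ε * x) ^ lam * (x ^ α * Real.exp (-x))) ∩ Set.Ioi (0 : ℝ) := by
    rintro x ⟨hx, hr⟩
    have hx' : 0 < x := hx
    refine ⟨?_, hx⟩
    have h1 : p.eval x ≠ 0 := fun h => hr (by simp [hp, h])
    rw [Function.mem_support, eval_mul]
    have : (1 + ε * x) ^ lam ≠ 0 := by positivity
    have h2 : x ^ α ≠ 0 := by positivity
    have h3 := (Real.exp_pos (-x)).ne'
    simp [*]
  refine lt_of_lt_of_le ?_ (measure_mono hsub)
  rw [measure_sdiff_null (Finset.measure_zero _ _)]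
  simp

theorem hasLaguerreMoments_deformedFunctional (hα : -1 < α) (lam : ℝ) :
    HasLaguerreMoments α (deformedFunctional hα lam le_rfl) := by
  intro k
  rw [deformedFunctional_apply, ← integral_pow_laguerreMeasure hα]
  simp

end LaguerreMeasure

/-! ### Expansion of the functional and control of the remainder `r`. -/

section Expansion

variable {α : ℝ}

theorem deformedFunctional_zero_apply (hα : -1 < α) (lam : ℝ) (p : ℝ[X]) :
    deformedFunctional hα lam le_rfl p = ∫ x, p.eval x ∂laguerreMeasure α := by
  simp [deformedFunctional_apply]

/-- Second order expansion of the deformed functional in `ε`. -/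
theorem exists_abs_deformedFunctional_sub_le (hα : -1 < α) (lam : ℝ) (p : ℝ[X]) :
    ∃ K : ℝ, 0 ≤ K ∧ ∀ (ε : ℝ) (hε : 0 ≤ ε), ε ≤ 1 →
      |deformedFunctional hα lam hε p - (deformedFunctional hα lam le_rfl p
        + lam * ε * deformedFunctional hα lam le_rfl (X * p)
        + lam * (lam - 1) / 2 * ε ^ 2 * deformedFunctional hα lam le_rfl (X * X * p))|
        ≤ K * ε ^ 3 := by
  obtain ⟨B, N, hB, hR⟩ := exists_abs_rpow_one_add_sub_quadratic_le lam
  have hint := (integrable_eval_laguerreMeasure hα (p * (X ^ 3 * (1 + X) ^ N))).norm.const_mul B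
  refine ⟨∫ x, B * ‖(p * (X ^ 3 * (1 + X) ^ N)).eval x‖ ∂laguerreMeasure α,
    integral_nonneg fun x => by positivity, fun ε hε hε1 => ?_⟩
  have i0 := integrable_eval_laguerreMeasure hα p
  have i1 := (integrable_eval_laguerreMeasure hα (X * p)).const_mul (lam * ε)
  have i2 := (integrable_eval_laguerreMeasure hα (X * X * p)).const_mul
    (lam * (lam - 1) / 2 * ε ^ 2)
  have i01 : Integrable (fun x => p.eval x + lam * ε * (X * p).eval x) (laguerreMeasure α) :=
    i0.add i1
  have i012 : Integrable (fun x => p.eval x + lam * ε * (X * p).eval x +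
      lam * (lam - 1) / 2 * ε ^ 2 * (X * X * p).eval x) (laguerreMeasure α) := i01.add i2
  have iw := integrable_eval_mul_rpow hα lam hε p
  rw [deformedFunctional_zero_apply, deformedFunctional_zero_apply, deformedFunctional_zero_apply,
    deformedFunctional_apply, ← integral_const_mul, ← integral_const_mul, ← integral_add i0 i1,
    ← integral_add i01 i2, ← integral_sub iw i012, ← integral_mul_const,
    ← Real.norm_eq_abs]
  refine norm_integral_le_of_norm_le (hint.mul_const _) ?_
  filter_upwards [ae_laguerreMeasure_pos α] with x hx
  have hu : 0 ≤ ε * x := by positivity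
  -- This replaces `(1 + ε x) ^ N` by `(1 + x) ^ N`, so that the bound is uniform in `ε`.
  have hux : ε * x ≤ x := by nlinarith
  simp only [eval_mul, eval_X, eval_pow, eval_add, eval_one]
  rw [show p.eval x * (1 + ε * x) ^ lam - (p.eval x + lam * ε * (x * p.eval x)
      + lam * (lam - 1) / 2 * ε ^ 2 * (x * x * p.eval x)) =
    p.eval x * ((1 + ε * x) ^ lam - 1 - lam * (ε * x) - lam * (lam - 1) / 2 * (ε * x) ^ 2) by ring,
    norm_mul, norm_mul, Real.norm_of_nonneg (show 0 ≤ x ^ 3 * (1 + x) ^ N by positivity)]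
  have h1 := (hR _ hu).trans (show B * (ε * x) ^ 3 * (1 + ε * x) ^ N ≤
    B * (ε * x) ^ 3 * (1 + x) ^ N by gcongr)
  calc ‖p.eval x‖ * ‖_‖ ≤ ‖p.eval x‖ * (B * (ε * x) ^ 3 * (1 + x) ^ N) := by
        gcongr
        exact h1
    _ = _ := by ring

/-- Weighted AM–GM: expand `(W r + D) ^ 2 / W ≥ 0` and bound `1 / W` by `V`. Here `W` will be the
deformation factor and `V` a polynomial. -/
theorem mul_le_half_add_half {r D W V : ℝ} (hW : 0 < W) (hV : 1 ≤ W * V) :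
    -(r * D) ≤ r ^ 2 * W / 2 + D ^ 2 * V / 2 := by
  have h1 : W⁻¹ ≤ V := (inv_le_iff_one_le_mul₀' hW).mpr hV
  have h2 : 0 ≤ W⁻¹ * (W * r + D) ^ 2 := by positivity
  have h3 : W⁻¹ * (W * r + D) ^ 2 = r ^ 2 * W + 2 * (r * D) + D ^ 2 * W⁻¹ := by
    field_simp
    ring
  have h4 : D ^ 2 * W⁻¹ ≤ D ^ 2 * V := by gcongr
  linarith

/-- If `l + ε q` satisfies the orthogonality conditions to first order in `ε`, then the
correction `r` needed to satisfy them exactly has squared norm `O(ε ^ 4)`. -/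
theorem exists_deformedFunctional_correction_le (hα : -1 < α) (lam : ℝ) (l q : ℝ[X]) :
    ∃ K : ℝ, 0 ≤ K ∧ ∀ (ε : ℝ) (hε : 0 ≤ ε), ε ≤ 1 → ∀ r : ℝ[X],
      deformedFunctional hα lam le_rfl (l * r) = 0 →
      deformedFunctional hα lam le_rfl (q * r)
        + lam * deformedFunctional hα lam le_rfl (l * (X * r)) = 0 →
      deformedFunctional hα lam hε ((l + ε • q + r) * r) = 0 →
      deformedFunctional hα lam hε (r * r) ≤ K * ε ^ 4 := by
  obtain ⟨B, N, hB, hR⟩ := exists_abs_rpow_one_add_sub_linear_le lam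
  set M := ⌈|-lam|⌉₊
  -- `ε ^ 2 * G` dominates the pointwise orthogonality defect of `l + ε q`; squared terms stand in
  -- for absolute values to keep `G` a polynomial. `(1 + X) ^ M` dominates the inverse of the
  -- deformation factor.
  set G : ℝ[X] := (2 + l ^ 2 + q ^ 2) * (C B * X ^ 2 * (1 + X) ^ N) + C |lam| * X * (1 + q ^ 2)
    with hG
  have hint := integrable_eval_laguerreMeasure hα (G ^ 2 * (1 + X) ^ M)
  refine ⟨∫ x, |(G ^ 2 * (1 + X) ^ M).eval x| ∂laguerreMeasure α,
    integral_nonneg fun x => abs_nonneg _, fun ε hε hε1 r h0 h1 h2 => ?_⟩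
  have i0 := integrable_eval_laguerreMeasure hα (l * r)
  have i1 := (integrable_eval_laguerreMeasure hα (q * r)).const_mul ε
  have i2 := (integrable_eval_laguerreMeasure hα (l * (X * r))).const_mul (ε * lam)
  have i01 : Integrable (fun x => (l * r).eval x + ε * (q * r).eval x) (laguerreMeasure α) :=
    i0.add i1
  have i012 : Integrable (fun x => (l * r).eval x + ε * (q * r).eval x +
      ε * lam * (l * (X * r)).eval x) (laguerreMeasure α) := i01.add i2
  have iw := integrable_eval_mul_rpow hα lam hε ((l + ε • q) * r)
  have ir := integrable_eval_mul_rpow hα lam hε (r * r)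
  -- Exact orthogonality turns the square of `r` into minus its pairing with `l + ε q`. The
  -- subtracted bracket is zero by the two lower-order conditions and leaves an integrand `-r D`
  -- with `D = O(ε ^ 2)`.
  have e1 : deformedFunctional hα lam hε (r * r) =
      -(deformedFunctional hα lam hε ((l + ε • q) * r) -
        (deformedFunctional hα lam le_rfl (l * r)
          + ε * deformedFunctional hα lam le_rfl (q * r)
          + ε * lam * deformedFunctional hα lam le_rfl (l * (X * r)))) := by
    rw [add_mul _ r, map_add] at h2
    linear_combination h2 - h0 - ε * h1
  have e2 : deformedFunctional hα lam hε (r * r) ≤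
      deformedFunctional hα lam hε (r * r) / 2 +
        (∫ x, |(G ^ 2 * (1 + X) ^ M).eval x| ∂laguerreMeasure α) * ε ^ 4 / 2 := by
    conv_lhs => rw [e1]
    rw [deformedFunctional_zero_apply, deformedFunctional_zero_apply,
      deformedFunctional_zero_apply,
      deformedFunctional_apply, ← integral_const_mul, ← integral_const_mul, ← integral_add i0 i1,
      ← integral_add i01 i2, ← integral_sub iw i012, ← integral_neg,
      deformedFunctional_apply, ← integral_mul_const, ← integral_div, ← integral_div,
      ← integral_add (ir.div_const 2) ((hint.abs.mul_const _).div_const 2)]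
    refine integral_mono_ae (iw.sub i012).neg
      ((ir.div_const 2).add ((hint.abs.mul_const _).div_const 2)) ?_
    filter_upwards [ae_laguerreMeasure_pos α] with x hx
    have hu : 0 ≤ ε * x := by positivity
    have hux : ε * x ≤ x := by nlinarith
    have hW : 0 < (1 + ε * x) ^ lam := by positivity
    set W := (1 + ε * x) ^ lam with hWdef
    have hWV : 1 ≤ W * (1 + x) ^ M := by
      have h3 : (1 + ε * x) ^ (-lam) ≤ (1 + x) ^ M :=
        (rpow_one_add_le_pow (-lam) hu).trans (by gcongr)
      rw [Real.rpow_neg (by positivity)] at h3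
      exact (inv_le_iff_one_le_mul₀' hW).mp h3
    have hD : |(l.eval x + ε * q.eval x) * (W - 1 - lam * (ε * x)) + ε ^ 2 * (lam * x * q.eval x)|
        ≤ ε ^ 2 * G.eval x := by
      have h3 := (hR _ hu).trans (show B * (ε * x) ^ 2 * (1 + ε * x) ^ N ≤
        B * (ε * x) ^ 2 * (1 + x) ^ N by gcongr)
      have hq : |q.eval x| ≤ 1 + q.eval x ^ 2 := abs_le.mpr ⟨by nlinarith, by nlinarith⟩
      have hl : |l.eval x| ≤ 1 + l.eval x ^ 2 := abs_le.mpr ⟨by nlinarith, by nlinarith⟩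
      have hlq : |l.eval x + ε * q.eval x| ≤ 2 + l.eval x ^ 2 + q.eval x ^ 2 := by
        refine (abs_add_le _ _).trans ?_
        rw [abs_mul, abs_of_nonneg hε]
        nlinarith [abs_nonneg (q.eval x)]
      refine (abs_add_le _ _).trans ?_
      rw [abs_mul, abs_mul (ε ^ 2), abs_mul (lam * x), abs_mul lam, abs_of_pos hx,
        abs_of_nonneg (sq_nonneg ε)]
      calc |l.eval x + ε * q.eval x| * |W - 1 - lam * (ε * x)|
            + ε ^ 2 * (|lam| * x * |q.eval x|)
          ≤ (2 + l.eval x ^ 2 + q.eval x ^ 2) * (B * (ε * x) ^ 2 * (1 + x) ^ N)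
            + ε ^ 2 * (|lam| * x * (1 + q.eval x ^ 2)) := by
            gcongr
        _ = ε ^ 2 * G.eval x := by
            simp only [hG, eval_add, eval_mul, eval_pow, eval_C, eval_X, eval_one, eval_ofNat]
            ring
    have h3 := mul_le_half_add_half (r := r.eval x) (D := (l.eval x + ε * q.eval x) *
      (W - 1 - lam * (ε * x)) + ε ^ 2 * (lam * x * q.eval x)) hW hWV
    have h4 := sq_le_sq' (neg_le_of_abs_le hD) (le_of_abs_le hD)
    have h5 : 0 ≤ (1 + x) ^ M := by positivity
    have h6 := mul_le_mul_of_nonneg_right h4 h5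
    simp only [eval_mul, eval_pow, eval_add, eval_one, eval_X, eval_smul, smul_eq_mul]
    rw [abs_of_nonneg (by positivity)]
    linarith
  -- The half of `Φ_ε(r ^ 2)` on the right is absorbed on the left.
  linarith

end Expansion

/-! ### Second-order perturbation of the squared norm. -/

namespace HasLaguerreMoments

/-- The first order correction to the monic Laguerre polynomial `L n` under the deformation. -/
theorem exists_first_order_correction {α : ℝ} {Φ : ℝ[X] →ₗ[ℝ] ℝ} {L : ℕ → ℝ[X]} (hα : -1 < α)
    (hΦ : HasLaguerreMoments α Φ) (hL : IsMonicOrthogonalFor Φ L)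
    (h0 : ∀ n, Φ (L n * L n) ≠ 0) (lam : ℝ) (n : ℕ) :
    ∃ q : ℝ[X], q.degree < n ∧
      (∀ r : ℝ[X], r.degree < n → Φ (q * r) + lam * Φ (L n * (X * r)) = 0) ∧
      Φ (L n * (X * q)) = -lam * (n * (n + α)) * Φ (L n * L n) := by
  rcases n with _ | n
  · refine ⟨0, by simp, fun r hr => ?_, by simp⟩
    have : r = 0 := by simpa [degree_lt_iff_coeff_zero, Polynomial.ext_iff] using hr
    simp [this]
  have hdX : ∀ r : ℝ[X], r.degree < (n + 1 : ℕ) →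
      Φ (L (n + 1) * (X * r)) = r.coeff n * Φ (L (n + 1) * L (n + 1)) := by
    intro r hr
    rw [hL.apply_mul_eq_coeff, coeff_X_mul]
    rw [degree_lt_iff_coeff_zero] at hr ⊢
    intro m hm
    obtain ⟨m, rfl⟩ : ∃ k, m = k + 1 := ⟨m - 1, by omega⟩
    rw [coeff_X_mul, hr m (by omega)]
  have hd : ((-lam * ((n + 1) * (n + 1 + α))) • L n).degree < (n + 1 : ℕ) := by
    rw [degree_lt_iff_coeff_zero]
    intro m hm
    rw [coeff_smul, hL.coeff_of_lt (by omega), smul_zero]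
  -- By `hdX`, the defect sees only the top coefficient of `r`, as pairing with `L n` does; the
  -- scalar is `-lam` times the ratio of consecutive squared norms.
  refine ⟨(-lam * ((n + 1) * (n + 1 + α))) • L n, hd, fun r hr => ?_, ?_⟩
  · rw [hdX r hr, smul_mul_assoc, map_smul, hL.apply_mul_eq_coeff hr,
      hΦ.apply_self_mul_self_succ hα hL h0, smul_eq_mul]
    ring
  · rw [hdX _ hd, coeff_smul, hL.coeff_self, smul_eq_mul]
    push_cast
    ring

end HasLaguerreMoments

/-- The elementary estimate that collects the error terms of the expansion of the norm. -/
theorem abs_expansion_sub_le {lam c2 A E b H ε K0 K1 K2 K3 y1 y2 y3 z1 z2 z3 z4 : ℝ}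
    (hε : 0 ≤ ε) (hε1 : ε ≤ 1) (hK0 : 0 ≤ K0) (hK2 : 0 ≤ K2) (hK3 : 0 ≤ K3)
    (hrr : 0 ≤ z4) (hcorr : z4 ≤ K0 * ε ^ 4)
    (a1 : |z1 - (H + lam * ε * (A * H) + c2 * ε ^ 2 * (E * H))| ≤ K1 * ε ^ 3)
    (a2 : |z2 - (0 + lam * ε * (-lam * b * H) + c2 * ε ^ 2 * y1)| ≤ K2 * ε ^ 3)
    (a3 : |z3 - (lam ^ 2 * b * H + lam * ε * y2 + c2 * ε ^ 2 * y3)| ≤ K3 * ε ^ 3) :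
    |z1 + 2 * ε * z2 + ε ^ 2 * z3 - z4 -
        H * (1 + lam * A * ε + (c2 * E - lam ^ 2 * b) * ε ^ 2)| ≤
      (K0 + K1 + 2 * (K2 + |c2 * y1|) + (K3 + |lam * y2| + |c2 * y3|)) * ε ^ 3 := by
  have hz4 : |z4| ≤ K0 * ε ^ 3 := by
    rw [abs_of_nonneg hrr]
    refine hcorr.trans ?_
    gcongr K0 * ?_
    exact pow_le_pow_of_le_one hε hε1 (by norm_num)
  have hε3 : ε ^ 4 ≤ ε ^ 3 := pow_le_pow_of_le_one hε hε1 (by norm_num)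
  have hε5 : ε ^ 5 ≤ ε ^ 3 := pow_le_pow_of_le_one hε hε1 (by norm_num)
  set d1 := z1 - (H + lam * ε * (A * H) + c2 * ε ^ 2 *
    (E * H)) with hd1
  set d2 := z2 - (0 + lam * ε * (-lam * b * H) + c2 * ε ^ 2 * y1) with hd2
  set d3 := z3 - (lam ^ 2 * b * H + lam * ε * y2 + c2 * ε ^ 2 * y3) with hd3
  -- The cross term contributes `-2 lam ^ 2 b H ε ^ 2` and the square of `q` contributes `lam ^ 2 b
  -- H ε ^ 2`; everything else is of order `ε ^ 3`.
  rw [show z1 + 2 * ε * z2 + ε ^ 2 * z3 - z4 - H * (1 + lam * A * ε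
          + (c2 * E
            - lam ^ 2 * b) * ε ^ 2) =
      d1 + 2 * (ε * d2 + c2 * y1 * ε ^ 3) + (ε ^ 2 * d3 + lam * y2 * ε ^ 3 + c2 * y3 * ε ^ 4)
        - z4 by rw [hd1, hd2, hd3]; ring]
  have t2 : |ε * d2| ≤ K2 * ε ^ 3 := by
    rw [abs_mul, abs_of_nonneg hε]
    calc ε * |d2| ≤ ε * (K2 * ε ^ 3) := by gcongr
      _ = K2 * ε ^ 4 := by ring
      _ ≤ K2 * ε ^ 3 := by gcongr
  have t3 : |ε ^ 2 * d3| ≤ K3 * ε ^ 3 := by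
    rw [abs_mul, abs_of_nonneg (sq_nonneg ε)]
    calc ε ^ 2 * |d3| ≤ ε ^ 2 * (K3 * ε ^ 3) := by gcongr
      _ = K3 * ε ^ 5 := by ring
      _ ≤ K3 * ε ^ 3 := by gcongr
  have t4 : |c2 * y1 * ε ^ 3| = |c2 * y1| * ε ^ 3 := by
    rw [abs_mul _ (ε ^ 3), abs_of_nonneg (a := ε ^ 3) (by positivity)]
  have t5 : |lam * y2 * ε ^ 3| = |lam * y2| * ε ^ 3 := by
    rw [abs_mul _ (ε ^ 3), abs_of_nonneg (a := ε ^ 3) (by positivity)]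
  have t6 : |c2 * y3 * ε ^ 4| ≤ |c2 * y3| * ε ^ 3 := by
    rw [abs_mul _ (ε ^ 4), abs_of_nonneg (a := ε ^ 4) (by positivity)]
    gcongr
  clear_value d1 d2 d3
  have u1 := abs_le.mp a1
  have u2 := abs_le.mp t2
  have u3 := abs_le.mp t3
  have u4 := abs_le.mp t4.le
  have u5 := abs_le.mp t5.le
  have u6 := abs_le.mp t6
  have u7 := abs_le.mp hz4
  rw [abs_le]
  constructor <;> linarith

/-- Expansion of the squared norm of the `n`-th monic orthogonal polynomial for the weight
`x ^ α e ^ (-x) (1 + ε x) ^ lam`. -/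
theorem exists_abs_deformed_norm_sub_le {α : ℝ} (hα : -1 < α) (lam : ℝ) (n : ℕ) :
    ∃ K : ℝ, 0 ≤ K ∧ ∀ (ε : ℝ) (hε : 0 ≤ ε), ε ≤ 1 → ∀ P : ℕ → ℝ[X],
      IsMonicOrthogonalFor (deformedFunctional hα lam hε) P →
      |deformedFunctional hα lam hε (P n * P n) -
        Real.Gamma (n + 1) * Real.Gamma (n + α + 1) * (1 + lam * (2 * n + α + 1) * ε
          + (lam * (lam - 1) / 2 * ((2 * n + α + 1) * (2 * n + α + 2) + 2 * (n * (n + α)))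
            - lam ^ 2 * (n * (n + α))) * ε ^ 2)| ≤ K * ε ^ 3 := by
  have hpos := deformedFunctional_mul_self_pos hα lam (le_refl 0)
  have hΦ := hasLaguerreMoments_deformedFunctional hα lam
  have hL := isMonicOrthogonalFor_gramSchmidtMonic hpos
  set Φ := deformedFunctional hα lam (le_refl 0)
  set L := gramSchmidtMonic Φ
  have h0 : ∀ n, Φ (L n * L n) ≠ 0 := fun n => (hpos _ (hL.monic n).ne_zero).ne'
  obtain ⟨q, hqd, hq1, hq2⟩ := hΦ.exists_first_order_correction hα hL h0 lam n
  obtain ⟨K0, hK0, H0⟩ := exists_deformedFunctional_correction_le hα lam (L n) q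
  obtain ⟨K1, hK1, H1⟩ := exists_abs_deformedFunctional_sub_le hα lam (L n * L n)
  obtain ⟨K2, hK2, H2⟩ := exists_abs_deformedFunctional_sub_le hα lam (L n * q)
  obtain ⟨K3, hK3, H3⟩ := exists_abs_deformedFunctional_sub_le hα lam (q * q)
  set c2 := lam * (lam - 1) / 2
  refine ⟨K0 + K1 + 2 * (K2 + |c2 * Φ (X * X * (L n * q))|) +
    (K3 + |lam * Φ (X * (q * q))| + |c2 * Φ (X * X * (q * q))|), by positivity,
    fun ε hε hε1 P hP => ?_⟩
  have hmon : (L n + ε • q).Monic := by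
    refine (hL.monic n).add_of_left ((degree_smul_le _ _).trans_lt ?_)
    rwa [degree_eq_natDegree (hL.monic n).ne_zero, hL.natDegree_eq]
  have hdeg : (L n + ε • q).natDegree = n := by
    have : (ε • q).degree < (L n).degree := by
      refine (degree_smul_le _ _).trans_lt ?_
      rwa [degree_eq_natDegree (hL.monic n).ne_zero, hL.natDegree_eq]
    rw [natDegree_eq_of_degree_eq (degree_add_eq_left_of_degree_lt this), hL.natDegree_eq]
  have hr := hP.degree_sub_lt hmon hdeg
  set r := P n - (L n + ε • q) with hrdef
  have hPr : P n = L n + ε • q + r := by rw [hrdef]; ring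
  have horth := hP.apply_mul_of_degree_lt hr
  have hcorr := H0 ε hε hε1 r (hL.apply_mul_of_degree_lt hr) (hq1 r hr) (hPr ▸ horth)
  have hrr : 0 ≤ deformedFunctional hα lam hε (r * r) := by
    by_cases h : r = 0
    · simp [h]
    · exact (deformedFunctional_mul_self_pos hα lam hε r h).le
  set Ψ := deformedFunctional hα lam hε
  -- Pythagoras: `L n + ε • q = P n - r`, and `P n` is orthogonal to `r`.
  have hexp : Ψ (P n * P n) = Ψ (L n * L n) + 2 * ε * Ψ (L n * q) + ε ^ 2 * Ψ (q * q)
      - Ψ (r * r) := by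
    have e1 : P n * P n = L n * L n + (2 * ε) • (L n * q) + (ε ^ 2) • (q * q)
        + (2 : ℝ) • (P n * r) - r * r := by
      simp only [smul_eq_C_mul] at hPr ⊢
      rw [hPr, C_mul, C_pow, show (C (2 : ℝ)) = 2 from rfl]
      ring
    rw [e1, map_sub, map_add, map_add, map_add, map_smul, map_smul, map_smul, horth]
    simp only [smul_eq_mul]
    ring
  have a1 := H1 ε hε hε1
  have a2 := H2 ε hε hε1
  have a3 := H3 ε hε hε1
  have b1 : Φ (X * (L n * L n)) = (2 * n + α + 1) * Φ (L n * L n) := by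
    rw [← hΦ.apply_X_mul_self_mul_self hα hL]; congr 1; ring
  have b2 := hΦ.apply_X_sq_mul_self_mul_self hα hL h0 n
  have b3 : Φ (L n * q) = 0 := hL.apply_mul_of_degree_lt hqd
  have b4 : Φ (X * (L n * q)) = -lam * (n * (n + α)) * Φ (L n * L n) := by
    rw [← hq2]; congr 1; ring
  -- The first-order condition is tested on `q` itself.
  have b5 : Φ (q * q) = lam ^ 2 * (n * (n + α)) * Φ (L n * L n) := by
    have := hq1 q hqd
    rw [hq2] at this
    linear_combination this
  have b6 := hΦ.apply_self_mul_self hα hL h0 n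
  rw [b1, b2] at a1
  rw [b3, b4] at a2
  rw [b5] at a3
  rw [b6] at a1 a2 a3
  rw [hexp]
  refine abs_expansion_sub_le hε hε1 hK0 hK2 hK3 hrr hcorr ?_ ?_ ?_
  · convert a1 using 3
  · convert a2 using 3
  · convert a3 using 3

/-! ### Passage to the logarithm and conclusion. -/

/-- Second order expansion of the logarithm of a quantity with a given second order expansion. -/
theorem abs_log_one_add_sub_le {A K B ε y : ℝ} (hε : 0 ≤ ε) (hε1 : ε ≤ 1) (hB : 0 ≤ B)
    (hy : |y - (A * ε + K * ε ^ 2)| ≤ B * ε ^ 3) (hs : (|A| + |K| + B) * ε ≤ 1 / 2) :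
    |Real.log (1 + y) - (A * ε + (K - A ^ 2 / 2) * ε ^ 2)| ≤
      (B + 2 * (|A| + |K| + B) ^ 3 + (|K| + B) * (|A| + |K| + B + |A|) / 2) * ε ^ 3 := by
  have hε2 : ε ^ 2 ≤ ε := by nlinarith
  have hε3 : ε ^ 3 ≤ ε ^ 2 := pow_le_pow_of_le_one hε hε1 (by norm_num)
  have h1 : |y - A * ε| ≤ (|K| + B) * ε ^ 2 := by
    calc |y - A * ε| = |(y - (A * ε + K * ε ^ 2)) + K * ε ^ 2| := by congr 1; ring
      _ ≤ |y - (A * ε + K * ε ^ 2)| + |K * ε ^ 2| := abs_add_le _ _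
      _ ≤ B * ε ^ 3 + |K| * ε ^ 2 := by
          rw [abs_mul K, abs_of_nonneg (sq_nonneg ε)]; gcongr
      _ ≤ B * ε ^ 2 + |K| * ε ^ 2 := by gcongr
      _ = _ := by ring
  have h2 : |y| ≤ (|A| + |K| + B) * ε := by
    calc |y| = |(y - A * ε) + A * ε| := by congr 1; ring
      _ ≤ |y - A * ε| + |A * ε| := abs_add_le _ _
      _ ≤ (|K| + B) * ε ^ 2 + |A| * ε := by rw [abs_mul A, abs_of_nonneg hε]; gcongr
      _ ≤ (|K| + B) * ε + |A| * ε := by gcongr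
      _ = _ := by ring
  have h3 : |y ^ 2 - (A * ε) ^ 2| ≤ (|K| + B) * (|A| + |K| + B + |A|) * ε ^ 3 := by
    calc |y ^ 2 - (A * ε) ^ 2| = |y - A * ε| * |y + A * ε| := by rw [← abs_mul]; congr 1; ring
      _ ≤ ((|K| + B) * ε ^ 2) * ((|A| + |K| + B) * ε + |A| * ε) := by
          gcongr
          refine (abs_add_le _ _).trans ?_
          rw [abs_mul A, abs_of_nonneg hε]
          gcongr
      _ = _ := by ring
  have h4 : |Real.log (1 + y) - y + y ^ 2 / 2| ≤ 2 * (|A| + |K| + B) ^ 3 * ε ^ 3 := by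
    -- By `h2` and `hs`, `|y| ≤ 1 / 2`, so the factor `1 / (1 - |y|)` is at most `2`.
    have h5 := Real.abs_log_sub_add_sum_range_le (x := -y) (by rw [abs_neg]; linarith) 2
    rw [abs_neg] at h5
    calc |Real.log (1 + y) - y + y ^ 2 / 2| ≤ |y| ^ 3 / (1 - |y|) := by
          refine le_trans (le_of_eq ?_) h5
          congr 1
          simp [Finset.sum_range_succ]
          ring
      _ ≤ 2 * |y| ^ 3 := by
          rw [div_le_iff₀ (by linarith)]
          nlinarith [pow_nonneg (abs_nonneg y) 3]
      _ ≤ 2 * ((|A| + |K| + B) * ε) ^ 3 := by gcongr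
      _ = _ := by ring
  rw [abs_le] at *
  constructor <;> nlinarith

theorem isMonicOrthogonalSequence_iff {α : ℝ} (hα : -1 < α) (lam : ℝ) {t : ℝ} (ht : 0 < t)
    (P : ℕ → ℝ[X]) : IsMonicOrthogonalSequence α lam t P ↔
      IsMonicOrthogonalFor (deformedFunctional hα lam (inv_nonneg.mpr ht.le)) P := by
  have h : t ^ lam ≠ 0 := (Real.rpow_pos_of_pos ht lam).ne'
  constructor
  · intro hP
    refine ⟨hP.monic, hP.natDegree_eq, fun j k hjk => ?_⟩
    have := hP.orthogonal j k hjk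
    rw [weightedInner_eq hα lam ht] at this
    exact (mul_eq_zero.mp this).resolve_left h
  · intro hP
    refine ⟨hP.monic, hP.natDegree_eq, fun j k hjk => ?_⟩
    rw [weightedInner_eq hα lam ht, hP.orthogonal j k hjk, mul_zero]

theorem mainTheorem6 (α lam : ℝ) (hα : -1 < α) :
    -- the monic orthogonal polynomials exist and are unique for each `t > 0`
    (∀ t : ℝ, 0 < t → ∃! P : ℕ → ℝ[X], IsMonicOrthogonalSequence α lam t P) ∧
    -- for these polynomials, `h n t = ∫ P_n(x;t)² w(x;t) dx` is positive, with the expansion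
    ∀ (P : ℝ → ℕ → ℝ[X]) (h : ℕ → ℝ → ℝ),
      (∀ t : ℝ, 0 < t → IsMonicOrthogonalSequence α lam t (P t)) →
      (∀ (j : ℕ) (t : ℝ), 0 < t → h j t = weightedInner α lam t (P t j) (P t j)) →
      ∀ n : ℕ,
        (∀ t : ℝ, 0 < t → 0 < h n t) ∧
        (fun t : ℝ =>
          Real.log (h n t) -
            (lam * Real.log t
              + Real.log (Real.Gamma ((n : ℝ) + 1) * Real.Gamma ((n : ℝ) + α + 1))
              + lam * (2 * (n : ℝ) + α + 1) / t
              - lam * (6 * (n : ℝ) ^ 2 + 2 * (n : ℝ) * (3 * α - lam + 3)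
                  + (α + 1) * (α - lam + 2)) / (2 * t ^ 2)))
          =O[atTop] fun t : ℝ => (t ^ 3)⁻¹ := by
  refine ⟨fun t ht => ?_, fun P h hP hh n => ?_⟩
  · have hpos := deformedFunctional_mul_self_pos hα lam (inv_nonneg.mpr ht.le)
    refine ⟨_, (isMonicOrthogonalSequence_iff hα lam ht _).mpr
      (isMonicOrthogonalFor_gramSchmidtMonic hpos), fun Q hQ => ?_⟩
    exact ((isMonicOrthogonalSequence_iff hα lam ht _).mp hQ).eq_of_pos hpos
      (isMonicOrthogonalFor_gramSchmidtMonic hpos)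
  have hpos : ∀ (t : ℝ) (ht : 0 < t),
      0 < deformedFunctional hα lam (inv_nonneg.mpr ht.le) (P t n * P t n) := fun t ht =>
    deformedFunctional_mul_self_pos hα lam _ _ ((hP t ht).monic n).ne_zero
  refine ⟨fun t ht => ?_, ?_⟩
  · rw [hh n t ht, weightedInner_eq hα lam ht]
    exact mul_pos (Real.rpow_pos_of_pos ht lam) (hpos t ht)
  obtain ⟨B, hB, H⟩ := exists_abs_deformed_norm_sub_le hα lam n
  have hn : (0 : ℝ) ≤ n := n.cast_nonneg
  have hG : 0 < Real.Gamma ((n : ℝ) + 1) * Real.Gamma ((n : ℝ) + α + 1) :=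
    mul_pos (Real.Gamma_pos_of_pos (by linarith)) (Real.Gamma_pos_of_pos (by linarith))
  set G := Real.Gamma ((n : ℝ) + 1) * Real.Gamma ((n : ℝ) + α + 1)
  set A := lam * (2 * (n : ℝ) + α + 1) with hA
  set K := lam * (lam - 1) / 2 * ((2 * n + α + 1) * (2 * n + α + 2) + 2 * (n * (n + α)))
    - lam ^ 2 * (n * (n + α)) with hK
  -- The constant is that of `abs_log_one_add_sub_le` for `y = F / G - 1`, whose cubic error
  -- constant is `B / G`. The two thresholds on `t` ensure `t⁻¹ ≤ 1` and the smallness condition.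
  refine IsBigO.of_bound
    (B / G + 2 * (|A| + |K| + B / G) ^ 3 + (|K| + B / G) * (|A| + |K| + B / G + |A|) / 2) ?_
  filter_upwards [eventually_ge_atTop 1, eventually_ge_atTop (2 * (|A| + |K| + B / G))]
    with t ht1 ht2
  have ht : 0 < t := by linarith
  have hε : 0 ≤ t⁻¹ := inv_nonneg.mpr ht.le
  have hε1 : t⁻¹ ≤ 1 := inv_le_one_of_one_le₀ ht1
  have hF := H t⁻¹ hε hε1 (P t) ((isMonicOrthogonalSequence_iff hα lam ht _).mp (hP t ht))
  have hFpos := hpos t ht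
  rw [hh n t ht, weightedInner_eq hα lam ht]
  set F := deformedFunctional hα lam (inv_nonneg.mpr ht.le) (P t n * P t n)
  have hy : |(F / G - 1) - (A * t⁻¹ + K * t⁻¹ ^ 2)| ≤ B / G * t⁻¹ ^ 3 := by
    rw [show (F / G - 1) - (A * t⁻¹ + K * t⁻¹ ^ 2) =
      (F - G * (1 + A * t⁻¹ + K * t⁻¹ ^ 2)) / G by field_simp; ring, abs_div, abs_of_pos hG,
      div_mul_eq_mul_div]
    gcongr
  have hs : (|A| + |K| + B / G) * t⁻¹ ≤ 1 / 2 := by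
    rw [← div_eq_mul_inv, div_le_iff₀ ht]
    linarith
  have hlog := abs_log_one_add_sub_le hε hε1 (by positivity) hy hs
  rw [Real.norm_eq_abs, Real.norm_of_nonneg (by positivity), ← inv_pow]
  refine le_trans (le_of_eq ?_) hlog
  congr 1
  rw [add_sub_cancel, Real.log_mul (Real.rpow_pos_of_pos ht lam).ne' hFpos.ne', Real.log_rpow ht,
    Real.log_div hFpos.ne' hG.ne']
  -- With `a = 2 n + α + 1`, `K - A ^ 2 / 2 = -lam / 2 * (a * (a + 1 - lam) + 2 n (n + α))`, which
  -- is the stated coefficient.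
  rw [hK, hA]
  field_simp
  ring
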